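/- Let $W$ denote the principal branch of the Lambert function; for $x>0$, $W(x)$ is the unique real number $w$ (necessarily positive) with $we^{w}=x$. A function $f:(0,\infty)\to\mathbb{R}$ is called a Stieltjes function if $$f(x)=a+\int_{[0,\infty)}\frac{d\mu(t)}{x+t}\qquad (x>0)$$ for some constant $a\ge 0$ and some positive Borel measure $\mu$ on $[0,\infty)$ with $\int_{[0,\infty)}(1+t)^{-1}\,d\mu(t)<\infty$. Let $\mathcal{S}$ be the set of all Stieltjes functions. Theorem. The following functions of $x>0$ belong to $\mathcal{S}$, for all real values of the parameters in the indicated ranges (where $W^{p}(y)$ means $(W(y))^{p}$): (a) $\dfrac{1}{c+W(x)}$, $c\ge 0$; (b) $W^{\alpha}(1/x)$, $0\le\alpha\le 1$; (c) $x^{\beta}W^{\beta}(1/x)$, $-1\le\beta\le 0$; (d) $\dfrac{W(x)}{x\,(c+W(x))}$, $c\ge 0$; (e) $\dfrac{1}{W(x)}-\dfrac{1}{x}$; (f) $c+W(x^{\beta})$, $c\ge 0$, $-1\le\beta\le 0$; (g) $\dfrac{1}{c+W(x^{\alpha})}$, $c\ge 0$, $0\le\alpha\le 1$; (h) $x^{\alpha\beta\gamma}\,W^{-\alpha\gamma}(x^{\beta})\,[1+W(x^{\beta})]^{1-\gamma}$,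 $0\le\alpha\le 1$, $-1\le\beta\le 0$, $0\le\gamma\le 1$; (i) $\dfrac{1}{c+x^{\alpha}}$, $0\le\alpha\le 1$, $c\ge 0$; (j) $1-x^{\alpha}W^{\alpha}(1/x)$, $0\le\alpha\le 1$; (k) $1-x^{-\alpha\beta}\,W^{\alpha}(x^{\beta})\,[1+W(x^{\beta})]^{-\alpha}$, $0\le\alpha\le 1$, $-1\le\beta\le 0$. -/

import Mathlib

/-- The real principal branch `W = W₀` of the Lambert function: on `[-1/e, ∞)` it is the inverse of
the bijection `w ↦ w * exp w` from `[-1, ∞)` onto `[-1/e, ∞)`. (For `x < -1/e` the value is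
unspecified.) In particular, for `x > 0`, `lambertW x` is the unique real `w` with
`w * exp w = x`; see `lambertW_eq_iff`. -/
noncomputable def lambertW (x : ℝ) : ℝ :=
  Function.invFunOn (fun w : ℝ => w * Real.exp w) (Set.Ici (-1)) x

/-- The defining property of the principal branch on `[-1/e, ∞)`. -/
theorem lambertW_spec {x : ℝ} (hx : -Real.exp (-1) ≤ x) :
    -1 ≤ lambertW x ∧ lambertW x * Real.exp (lambertW x) = x := by
  have hb : x ≤ max x 0 * Real.exp (max x 0) := by
    have h0 : (0 : ℝ) ≤ max x 0 := le_max_right _ _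
    have h1 : (1 : ℝ) ≤ Real.exp (max x 0) := Real.one_le_exp h0
    have h2 : x ≤ max x 0 := le_max_left _ _
    nlinarith
  have hab : (-1 : ℝ) ≤ max x 0 := le_trans (by norm_num) (le_max_right x 0)
  have hc : ContinuousOn (fun w : ℝ => w * Real.exp w) (Set.Icc (-1) (max x 0)) := by
    fun_prop
  obtain ⟨w, hw, hwx⟩ := intermediate_value_Icc hab hc
    (show x ∈ Set.Icc _ _ from ⟨by simpa using hx, hb⟩)
  have hex : ∃ w ∈ Set.Ici (-1 : ℝ), (fun w : ℝ => w * Real.exp w) w = x := ⟨w, hw.1, hwx⟩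
  exact ⟨Function.invFunOn_mem hex, Function.invFunOn_eq hex⟩

/-- On the positive half-line, `lambertW x` is the unique real solution of `w * exp w = x`. -/
theorem lambertW_eq_iff {x : ℝ} (hx : 0 < x) (w : ℝ) :
    lambertW x = w ↔ w * Real.exp w = x := by
  have hs := (lambertW_spec (x := x) (by linarith [Real.exp_pos (-1)])).2
  constructor
  · rintro rfl
    exact hs
  · intro h
    have pos : ∀ v : ℝ, v * Real.exp v = x → 0 < v := fun v hv => by
      by_contra hn
      nlinarith [Real.exp_pos v]
    have key : ∀ u v : ℝ, u * Real.exp u = x → v * Real.exp v = x → u < v → False := by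
      intro u v hu hv huv
      have h1 := Real.exp_lt_exp.mpr huv
      nlinarith [pos u hu, Real.exp_pos u]
    rcases lt_trichotomy (lambertW x) w with hlt | heq | hgt
    · exact (key _ _ hs h hlt).elim
    · exact heq
    · exact (key _ _ h hs hgt).elim

/-- `f`, regarded as a function on `(0, ∞)` (its values elsewhere are irrelevant), is a Stieltjes
function: `f x = a + ∫_{[0,∞)} dμ(t) / (x + t)` for all `x > 0`, with a constant `a ≥ 0` and a
positive Borel measure `μ` on `[0, ∞)` such that `∫_{[0,∞)} dμ(t) / (1 + t) < ∞`. The measure is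
carried by `ℝ`, and only its restriction to `[0, ∞)` is used. -/
def IsStieltjes (f : ℝ → ℝ) : Prop :=
  ∃ a : ℝ, 0 ≤ a ∧ ∃ μ : MeasureTheory.Measure ℝ,
    MeasureTheory.IntegrableOn (fun t : ℝ => 1 / (1 + t)) (Set.Ici 0) μ ∧
    ∀ x : ℝ, 0 < x → f x = a + ∫ t in Set.Ici (0 : ℝ), 1 / (x + t) ∂μ

/-! A function holomorphic on the plane cut along `(-∞, 0]`, nonnegative on `(0, ∞)` and with `Im f
≤ 0` on the upper half-plane is Stieltjes (`isStieltjes_of_upper`). To see this, pull `f` back to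
the unit disc and dilate by `r < 1`. A Poisson-type formula then represents the real part on the
diameter by a positive measure whose density is built from `-Im f`. The masses are bounded, so a
weak limit exists as `r → 1`. It lives on the compactified half-line, and nonnegativity of `f` at
large `x` excludes mass at infinity.

To apply this, `W(z^β)` is continued as `ω(β log z)`, where `ω` inverts `w + log w` from the strip
`|Im y| < π` onto the slit plane. When `0 < Im y < π`, the value `w = ω(y)` satisfies `Im w > 0` and
`Im w + arg w < π`. Through `y / W(y) = exp (W(y))` every listed function involving `W` becomes
`G(W(x^β))` with `G` elementary. The sign of `Im G(w)` is either immediate or comes from an angle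
such as `a Im w + b arg (c + w)` with `a, b ∈ [0, 1]`, which that inequality keeps in `[0, π]`. -/

/-! ### Weak limits and a Poisson formula on the disc. -/

open MeasureTheory Filter Topology in
/-- Finite measures of bounded mass on a compact space have a weak cluster point. -/
theorem exists_finiteMeasure_integral_eq_of_tendsto {X : Type*} [TopologicalSpace X]
    [CompactSpace X] [T2Space X] [MeasurableSpace X] [BorelSpace X]
    (C : NNReal) (ν : ℕ → FiniteMeasure X) (hν : ∀ n, (ν n).mass ≤ C) :
    ∃ μ : FiniteMeasure X, ∀ (k : C(X, ℝ)) (l : ℝ),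
      Tendsto (fun n => ∫ x, k x ∂(ν n : Measure X)) atTop (𝓝 l) →
        ∫ x, k x ∂(μ : Measure X) = l := by
  have hc := isCompact_setOfPred_finiteMeasure_le_of_compactSpace X C
  -- A limit along one ultrafilter suffices: integrals that already converge must converge to the
  -- same value along it, so no subsequence is needed.
  obtain ⟨μ, -, hμ⟩ := isCompact_iff_ultrafilter_le_nhds.1 hc
    ((Filter.hyperfilter ℕ).map ν) (by
      simp only [Ultrafilter.coe_map, le_principal_iff, mem_map]
      exact Filter.univ_mem' hν)
  refine ⟨μ, fun k l hk => ?_⟩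
  have h1 : Tendsto ν (hyperfilter ℕ : Filter ℕ) (𝓝 μ) := hμ
  have h2 := (FiniteMeasure.tendsto_iff_forall_integral_tendsto.1 h1)
    (BoundedContinuousFunction.mkOfCompact k)
  have h3 : Tendsto (fun n => ∫ x, k x ∂(ν n : Measure X)) (hyperfilter ℕ : Filter ℕ) (𝓝 l) :=
    hk.mono_left Nat.hyperfilter_le_atTop
  exact tendsto_nhds_unique h2 h3

-- On the unit circle `1 / z` is the conjugate of `z`, so for real `w` the first fraction is the
-- conjugate of the second. Their difference is therefore purely imaginary.
open Complex MeasureTheory Metric in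
theorem circle_kernel_sub (w θ : ℝ) (hw : |w| < 1) :
    circleMap 0 1 θ / (circleMap 0 1 θ - w) - 1 / (1 - w * circleMap 0 1 θ) =
      ((-2 * (w * Real.sin θ / (1 - 2 * w * Real.cos θ + w ^ 2)) : ℝ) : ℂ) * I := by
  have hz : circleMap 0 1 θ = Real.cos θ + Real.sin θ * I := by
    simp [circleMap, exp_mul_I]
  have hden : 0 < 1 - 2 * w * Real.cos θ + w ^ 2 := by
    have := Real.abs_cos_le_one θ
    have h1 : w * Real.cos θ ≤ |w| := by
      calc w * Real.cos θ ≤ |w * Real.cos θ| := le_abs_self _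
        _ = |w| * |Real.cos θ| := abs_mul _ _
        _ ≤ |w| * 1 := by gcongr
        _ = |w| := mul_one _
    nlinarith [sq_abs w]
  have hden' : ((1 - 2 * w * Real.cos θ + w ^ 2 : ℝ) : ℂ) ≠ 0 := by
    exact_mod_cast hden.ne'
  have hcs : (Real.cos θ : ℂ) ^ 2 + (Real.sin θ : ℂ) ^ 2 = 1 := by
    exact_mod_cast Real.cos_sq_add_sin_sq θ
  generalize Real.cos θ = c at *
  generalize Real.sin θ = s at *
  have hprod : (1 - w * circleMap 0 1 θ) * (1 - w * (c - s * I)) =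
      ((1 - 2 * w * c + w ^ 2 : ℝ) : ℂ) := by
    rw [hz]; push_cast
    linear_combination (w : ℂ) ^ 2 * hcs - (w : ℂ) ^ 2 * (s : ℂ) ^ 2 * I_sq
  have hzz : circleMap 0 1 θ * (c - s * I) = 1 := by
    rw [hz]; linear_combination hcs - (s : ℂ) ^ 2 * I_sq
  have ha : (1 - w * circleMap 0 1 θ) ≠ 0 := by
    intro h; rw [h, zero_mul] at hprod; exact hden' hprod.symm
  have hb : (1 - w * (c - s * I) : ℂ) ≠ 0 := by
    intro h; rw [h, mul_zero] at hprod; exact hden' hprod.symm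
  have hz0 : circleMap 0 1 θ ≠ 0 := left_ne_zero_of_mul_eq_one hzz
  have hcz : circleMap 0 1 θ - w =
      circleMap 0 1 θ * (1 - w * (c - s * I)) := by
    linear_combination (w : ℂ) * hzz
  rw [hcz, div_mul_cancel_left₀ hz0, inv_eq_one_div, div_sub_div _ _ hb ha,
    mul_comm (1 - (w : ℂ) * (c - s * I)) (1 - (w : ℂ) * circleMap 0 1 θ), hprod]
  rw [hz]
  push_cast at hden' ⊢
  field_simp
  ring

open Complex MeasureTheory Metric in
/-- A Poisson type formula recovering the real part on the diameter from the imaginary part on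
the circle. -/
theorem re_sub_re_eq_integral_im {h : ℂ → ℂ} (hd : DiffContOnCl ℂ h (ball 0 1)) {w : ℝ}
    (hw : |w| < 1) :
    (h w).re - (h 0).re = Real.pi⁻¹ * ∫ θ in 0..2 * Real.pi,
      (h (circleMap 0 1 θ)).im * (w * Real.sin θ / (1 - 2 * w * Real.cos θ + w ^ 2)) := by
  have hball : (w : ℂ) ∈ ball (0 : ℂ) |1| := by simpa using hw
  have e1 := DiffContOnCl.circleAverage_smul_div (R := 1) (c := 0) (by simpa using hd) hball
  have hne : ∀ z ∈ closedBall (0 : ℂ) 1, (1 - w * z) ≠ 0 := by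
    intro z hz h0
    have h1 : ‖(w : ℂ) * z‖ < 1 := by
      rw [norm_mul, norm_real, Real.norm_eq_abs]
      have : ‖z‖ ≤ 1 := by simpa using hz
      nlinarith [abs_nonneg w, norm_nonneg z]
    rw [← sub_eq_zero.1 h0] at h1
    simp at h1
  -- The mean value property of this function gives `h 0`, as Cauchy's formula gives `h w`.
  -- Subtracting leaves an imaginary kernel, whose product with `h` has a real part involving only
  -- `Im h`.
  have hd2 : DiffContOnCl ℂ (fun z : ℂ => (1 / (1 - w * z)) • h z) (ball 0 1) := by
    refine DiffContOnCl.smul (c := fun z : ℂ => 1 / (1 - w * z)) ?_ hd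
    refine DifferentiableOn.diffContOnCl fun z hz => ?_
    rw [closure_ball _ one_ne_zero] at hz
    exact (DifferentiableAt.div (c := fun _ : ℂ => (1 : ℂ)) (d := fun z : ℂ => 1 - w * z) (by fun_prop)
      (by fun_prop) (hne z hz)).differentiableWithinAt
  have e2 := DiffContOnCl.circleAverage (R := 1) (c := 0) (f := fun z : ℂ => (1 / (1 - w * z)) • h z)
    (by rwa [abs_one])
  have hcont : ContinuousOn h (closedBall 0 1) := by
    rw [← closure_ball _ one_ne_zero]; exact hd.2
  have hmem : ∀ θ, circleMap 0 1 θ ∈ closedBall (0 : ℂ) 1 := fun θ => by simp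
  have hhc : Continuous fun θ => h (circleMap 0 1 θ) :=
    hcont.comp_continuous (continuous_circleMap 0 1) hmem
  have c2 : Continuous fun θ : ℝ => (1 / (1 - w * circleMap 0 1 θ)) • h (circleMap 0 1 θ) := by
    refine Continuous.smul (Continuous.div continuous_const ?_ fun θ => hne _ (hmem θ)) hhc
    exact continuous_const.sub (continuous_const.mul (continuous_circleMap 0 1))
  have c1 : Continuous fun θ : ℝ => (circleMap 0 1 θ / (circleMap 0 1 θ - w)) •
      h (circleMap 0 1 θ) := by
    refine Continuous.smul (Continuous.div (continuous_circleMap 0 1)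
      ((continuous_circleMap 0 1).sub continuous_const) fun θ h0 => ?_) hhc
    have h1 : ‖circleMap 0 1 θ‖ = 1 := by simp
    rw [sub_eq_zero.1 h0, norm_real, Real.norm_eq_abs] at h1
    exact hw.ne h1
  rw [Real.circleAverage_def] at e1 e2
  have e3 : h w - h 0 = (2 * Real.pi)⁻¹ • ∫ θ in 0..2 * Real.pi,
      (((-2 * (w * Real.sin θ / (1 - 2 * w * Real.cos θ + w ^ 2)) : ℝ) : ℂ) * I) *
        h (circleMap 0 1 θ) := by
    rw [← e1]
    conv_lhs => rw [show h 0 = (1 / (1 - w * (0 : ℂ))) • h 0 by simp]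
    rw [← e2, ← smul_sub, ← intervalIntegral.integral_sub]
    · congr 1
      refine intervalIntegral.integral_congr fun θ _ => ?_
      simp only [sub_zero, smul_eq_mul, ← circle_kernel_sub w θ hw]
      ring
    · simpa using c1.intervalIntegrable _ _
    · exact c2.intervalIntegrable _ _
  have cI : Continuous fun θ : ℝ =>
      (((-2 * (w * Real.sin θ / (1 - 2 * w * Real.cos θ + w ^ 2)) : ℝ) : ℂ) * I) *
        h (circleMap 0 1 θ) := by
    have : (fun θ : ℝ =>
      (((-2 * (w * Real.sin θ / (1 - 2 * w * Real.cos θ + w ^ 2)) : ℝ) : ℂ) * I) *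
        h (circleMap 0 1 θ)) = fun θ =>
        (circleMap 0 1 θ / (circleMap 0 1 θ - w)) • h (circleMap 0 1 θ) -
        (1 / (1 - w * circleMap 0 1 θ)) • h (circleMap 0 1 θ) := by
      funext θ
      rw [← circle_kernel_sub w θ hw, smul_eq_mul, smul_eq_mul]; ring
    rw [this]; exact c1.sub c2
  have e4 := congrArg Complex.re e3
  rw [sub_re, smul_re, ← reCLM_apply (∫ θ in _.._, _),
    ← ContinuousLinearMap.intervalIntegral_comp_comm _ (cI.intervalIntegrable _ _)] at e4
  rw [e4]
  simp only [reCLM_apply, re_ofReal_mul, mul_assoc, I_mul_re, smul_eq_mul]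
  rw [← intervalIntegral.integral_const_mul, ← intervalIntegral.integral_const_mul]
  refine intervalIntegral.integral_congr fun θ _ => ?_
  have := Real.pi_ne_zero
  field_simp

/-! ### Representation of functions on the slit plane. -/

open Complex in
/-- A conformal map of the unit disc onto the slit plane. -/
noncomputable def discToSlitPlane (w : ℂ) : ℂ := ((1 + w) / (1 - w)) ^ 2

-- The Cayley transform sends the disc into the right half-plane, keeping the sign of the imaginary
-- part. Squaring keeps it too, since `Im q² = 2 Re q Im q`.
open Complex in
theorem cayley_re_im {w : ℂ} (hw : ‖w‖ < 1) :
    0 < ((1 + w) / (1 - w)).re ∧ ∃ k : ℝ, 0 < k ∧ ((1 + w) / (1 - w)).im = k * w.im := by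
  have h1 : 0 < normSq (1 - w) := by
    rw [normSq_pos]
    intro h
    rw [← sub_eq_zero.1 h] at hw
    simp at hw
  have h2 : w.re * w.re + w.im * w.im < 1 := by
    have := normSq_eq_norm_sq w
    rw [normSq_apply] at this
    nlinarith [norm_nonneg w]
  refine ⟨?_, 2 / normSq (1 - w), by positivity, ?_⟩
  · rw [div_re, ← add_div]
    apply div_pos _ h1
    simp
    nlinarith
  · rw [div_im, ← sub_div, div_mul_eq_mul_div]
    congr 1
    simp
    ring

open Complex in
theorem discToSlitPlane_mem {w : ℂ} (hw : ‖w‖ < 1) : discToSlitPlane w ∈ slitPlane := by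
  obtain ⟨h1, -⟩ := cayley_re_im hw
  unfold discToSlitPlane
  generalize (1 + w) / (1 - w) = q at *
  rw [mem_slitPlane_iff, sq, mul_re, mul_im]
  by_cases h : q.im = 0
  · left; rw [h]; nlinarith
  · right
    have : q.re * q.im ≠ 0 := mul_ne_zero h1.ne' h
    intro h0; apply this; linarith

open Complex in
theorem discToSlitPlane_im {w : ℂ} (hw : ‖w‖ < 1) :
    ∃ k : ℝ, 0 < k ∧ (discToSlitPlane w).im = k * w.im := by
  obtain ⟨h1, k, hk, h2⟩ := cayley_re_im hw
  refine ⟨2 * (((1 + w) / (1 - w)).re * k), by positivity, ?_⟩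
  unfold discToSlitPlane
  generalize (1 + w) / (1 - w) = q at *
  rw [sq, mul_im, h2]
  ring

open Complex in
theorem differentiableAt_discToSlitPlane {w : ℂ} (hw : ‖w‖ < 1) :
    DifferentiableAt ℂ discToSlitPlane w := by
  have h : 1 - w ≠ 0 := by
    intro h
    rw [← sub_eq_zero.1 h] at hw
    simp at hw
  unfold discToSlitPlane
  exact DifferentiableAt.pow (DifferentiableAt.div (by fun_prop) (by fun_prop) h) 2

/-- The map `θ ↦ (1 - cos θ) / 2` into the unit interval. -/
noncomputable def halfVersine (θ : ℝ) : unitInterval :=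
  ⟨(1 - Real.cos θ) / 2, by linarith [Real.cos_le_one θ], by linarith [Real.neg_one_le_cos θ]⟩

theorem continuous_halfVersine : Continuous halfVersine := by
  unfold halfVersine
  exact Continuous.subtype_mk (by fun_prop) _

open Complex MeasureTheory in
/-- The dilations of a Stieltjes type function have a representation by a finite measure. -/
theorem exists_finiteMeasure_dilation {f : ℂ → ℂ} (hf : DifferentiableOn ℂ f slitPlane)
    (him : ∀ z ∈ slitPlane, z.im * (f z).im ≤ 0) {r : ℝ} (hr0 : 0 < r) (hr1 : r < 1) :
    ∃ ν : FiniteMeasure unitInterval, ∀ w x : ℝ, |w| < 1 → x = ((1 + w) / (1 - w)) ^ 2 →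
      (f (discToSlitPlane (r * w))).re = (f 1).re -
        ∫ s : unitInterval, (x - 1) / (x * s + (1 - s)) ∂(ν : Measure unitInterval) := by
  set h : ℂ → ℂ := fun z => f (discToSlitPlane (r * z)) with hh
  have hnorm : ∀ z : ℂ, ‖z‖ ≤ 1 → ‖(r : ℂ) * z‖ < 1 := by
    intro z hz
    rw [norm_mul, norm_real, Real.norm_eq_abs, abs_of_pos hr0]
    nlinarith [norm_nonneg z]
  have hdiff : ∀ z : ℂ, ‖z‖ ≤ 1 → DifferentiableAt ℂ h z := by
    intro z hz
    have h1 := discToSlitPlane_mem (hnorm z hz)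
    have h2 : DifferentiableAt ℂ f (discToSlitPlane (r * z)) :=
      hf.differentiableAt (isOpen_slitPlane.mem_nhds h1)
    have h3 : DifferentiableAt ℂ (fun z => discToSlitPlane (r * z)) z :=
      DifferentiableAt.comp z (g := discToSlitPlane) (f := fun z => (r : ℂ) * z)
        (differentiableAt_discToSlitPlane (hnorm z hz)) (by fun_prop)
    exact DifferentiableAt.comp z (g := f) h2 h3
  have hd : DiffContOnCl ℂ h (Metric.ball 0 1) := by
    refine DifferentiableOn.diffContOnCl fun z hz => ?_
    rw [closure_ball _ one_ne_zero] at hz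
    exact (hdiff z (by simpa using hz)).differentiableWithinAt
  have hc : Continuous fun θ : ℝ => h (circleMap 0 1 θ) := by
    rw [continuous_iff_continuousAt]
    intro θ
    exact ContinuousAt.comp (g := h) (hdiff _ (by simp)).continuousAt
      (continuous_circleMap 0 1).continuousAt
  set m : ℝ → ℝ := fun θ => (4 * Real.pi)⁻¹ * (-((h (circleMap 0 1 θ)).im * Real.sin θ)) with hm
  have hmc : Continuous m := by
    have := continuous_im.comp hc
    simp only [Function.comp_def] at this
    fun_prop
  have hm0 : ∀ θ, 0 ≤ m θ := by
    intro θ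
    have h1 : ‖circleMap 0 1 θ‖ ≤ 1 := by simp
    obtain ⟨k, hk, hk'⟩ := discToSlitPlane_im (hnorm _ h1)
    have h2 := him _ (discToSlitPlane_mem (hnorm _ h1))
    have h3 : (circleMap 0 1 θ).im = Real.sin θ := by
      simp [circleMap, exp_mul_I, sin_ofReal_re]
    rw [hk', im_ofReal_mul, h3] at h2
    have h4 : (k * r) * ((h (circleMap 0 1 θ)).im * Real.sin θ) ≤ 0 := by
      calc _ = k * (r * Real.sin θ) * (f (discToSlitPlane (r * circleMap 0 1 θ))).im := by
            simp only [hh]; ring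
        _ ≤ 0 := h2
    have h5 : (h (circleMap 0 1 θ)).im * Real.sin θ ≤ 0 :=
      nonpos_of_mul_nonpos_right h4 (by positivity)
    have := Real.pi_pos
    exact mul_nonneg (by positivity) (by linarith)
  set ρ : Measure ℝ := (volume.restrict (Set.Ioc 0 (2 * Real.pi))).withDensity
    (fun θ => ((m θ).toNNReal : ENNReal)) with hρ
  have hfin : IsFiniteMeasure ρ := by
    apply isFiniteMeasure_withDensity_ofReal
    exact ((hmc.integrableOn_Icc (a := 0) (b := 2 * Real.pi)).mono_set
      Set.Ioc_subset_Icc_self).hasFiniteIntegral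
  -- The boundary point `exp (iθ)` corresponds to `-t` on the cut with `t = cot² (θ/2)`; the compact
  -- coordinate is `s = 1 / (1 + t) = sin² (θ/2)`, which is `halfVersine θ`.
  refine ⟨⟨ρ.map halfVersine, inferInstance⟩, fun w x hw hx => ?_⟩
  have hw1 : 0 < 1 - w := by linarith [(abs_lt.1 hw).2]
  have hw2 : 0 < 1 + w := by linarith [(abs_lt.1 hw).1]
  have hx0 : 0 < x := by rw [hx]; positivity
  have hden : ∀ s : unitInterval, 0 < x * s + (1 - s) := by
    intro s
    rcases s with ⟨s, hs0, hs1⟩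
    rcases eq_or_lt_of_le hs0 with h | h
    · simp [← h]
    · have : 0 < x * s := by positivity
      simp only; linarith
  have hkc : Continuous fun s : unitInterval => (x - 1) / (x * s + (1 - s)) :=
    Continuous.div continuous_const (by fun_prop) fun s => (hden s).ne'
  have e1 := re_sub_re_eq_integral_im hd hw
  have h0 : h 0 = f 1 := by simp [hh, discToSlitPlane]
  rw [h0] at e1
  change (h w).re = _
  rw [FiniteMeasure.toMeasure_mk,
    integral_map continuous_halfVersine.measurable.aemeasurable hkc.aestronglyMeasurable, hρ,
    integral_withDensity_eq_integral_smul (by fun_prop),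
    ← intervalIntegral.integral_of_le (by have := Real.pi_pos; positivity)]
  rw [sub_eq_iff_eq_add] at e1
  rw [e1, add_comm, sub_eq_add_neg, ← intervalIntegral.integral_neg,
    ← intervalIntegral.integral_const_mul]
  congr 1
  refine intervalIntegral.integral_congr fun θ _ => ?_
  simp only [NNReal.smul_def, Real.coe_toNNReal _ (hm0 θ), smul_eq_mul]
  have hk2 := hden (halfVersine θ)
  have hk3 : w / (1 - 2 * w * Real.cos θ + w ^ 2) =
      (x - 1) / (4 * (x * (halfVersine θ : ℝ) + (1 - (halfVersine θ : ℝ)))) := by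
    have hid : (x * (halfVersine θ : ℝ) + (1 - (halfVersine θ : ℝ))) * (1 - w) ^ 2 =
        1 - 2 * w * Real.cos θ + w ^ 2 := by
      simp only [halfVersine, hx]; field_simp; ring
    have hx1 : (x - 1) * (1 - w) ^ 2 = 4 * w := by
      rw [hx]; field_simp; ring
    rw [← hid, div_eq_div_iff (by positivity) (by positivity)]
    linear_combination (-(x * (halfVersine θ : ℝ) + (1 - (halfVersine θ : ℝ)))) * hx1
  rw [mul_comm w, mul_div_assoc, hk3, hm]
  have := Real.pi_ne_zero
  generalize (x * (halfVersine θ : ℝ) + (1 - (halfVersine θ : ℝ))) = D at *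
  field_simp

open MeasureTheory Filter Topology in
/-- Functions represented by a finite measure on the (compactified) half line that are nonnegative
are Stieltjes functions. -/
theorem isStieltjes_of_finiteMeasure {F : ℝ → ℝ} (hF : ∀ x, 0 < x → 0 ≤ F x) {A : ℝ}
    (ν : Measure unitInterval) [IsFiniteMeasure ν]
    (hν : ∀ x, 0 < x → F x = A - ∫ s : unitInterval, (x - 1) / (x * s + (1 - s)) ∂ν) :
    IsStieltjes F := by
  have hpos : ∀ (n : ℕ) (s : unitInterval), 0 < (s : ℝ) + 1 / (n + 1) := fun n s =>
    add_pos_of_nonneg_of_pos s.2.1 (by positivity)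
  have hcont : ∀ n : ℕ, Continuous fun s : unitInterval => 1 / ((s : ℝ) + 1 / (n + 1)) := fun n =>
    Continuous.div continuous_const (by fun_prop) fun s => (hpos n s).ne'
  have hint : ∀ n : ℕ, Integrable (fun s : unitInterval => 1 / ((s : ℝ) + 1 / (n + 1))) ν :=
    fun n => (BoundedContinuousFunction.mkOfCompact ⟨_, hcont n⟩).integrable ν
  -- This is `0 ≤ F (n + 2)`, where the kernel is exactly this integrand. Fatou then bounds the
  -- integral of `1 / s`.
  have hle : ∀ n : ℕ, ∫ s : unitInterval, 1 / ((s : ℝ) + 1 / (n + 1)) ∂ν ≤ A := by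
    intro n
    have hn : (0 : ℝ) < n + 1 := by positivity
    have h1 := hF (n + 2) (by positivity)
    rw [hν (n + 2) (by positivity)] at h1
    have h2 : ∀ s : unitInterval, ((n : ℝ) + 2 - 1) / ((n + 2) * s + (1 - s)) =
        1 / ((s : ℝ) + 1 / (n + 1)) := by
      intro s
      have h3 := hpos n s
      have h4 : ((n : ℝ) + 2) * s + (1 - s) = (n + 1) * ((s : ℝ) + 1 / (n + 1)) := by
        field_simp; ring
      rw [h4, show (n : ℝ) + 2 - 1 = (n + 1) * 1 by ring, mul_div_mul_left _ _ hn.ne']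
    simp only [h2] at h1
    linarith
  have hlint : ∫⁻ s : unitInterval, (ENNReal.ofReal s)⁻¹ ∂ν ≤ ENNReal.ofReal A := by
    have hlim : ∀ s : unitInterval, Tendsto
        (fun n : ℕ => ENNReal.ofReal (1 / ((s : ℝ) + 1 / (n + 1)))) atTop
        (𝓝 (ENNReal.ofReal s)⁻¹) := by
      intro s
      have h1 : Tendsto (fun n : ℕ => (s : ℝ) + 1 / ((n : ℝ) + 1)) atTop (𝓝 s) := by
        simpa using tendsto_const_nhds.add (tendsto_one_div_add_atTop_nhds_zero_nat (𝕜 := ℝ))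
      have h2 := tendsto_inv_iff.2 (ENNReal.tendsto_ofReal h1)
      refine h2.congr fun n => ?_
      rw [← ENNReal.ofReal_inv_of_pos (hpos n s)]
      simp only [one_div]
    calc ∫⁻ s : unitInterval, (ENNReal.ofReal s)⁻¹ ∂ν
        = ∫⁻ s : unitInterval, liminf
          (fun n : ℕ => ENNReal.ofReal (1 / ((s : ℝ) + 1 / (n + 1)))) atTop ∂ν :=
          lintegral_congr fun s => (hlim s).liminf_eq.symm
      _ ≤ liminf (fun n : ℕ => ∫⁻ s : unitInterval,
          ENNReal.ofReal (1 / ((s : ℝ) + 1 / (n + 1))) ∂ν) atTop :=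
          lintegral_liminf_le fun n => (hcont n).measurable.ennreal_ofReal
      _ ≤ ENNReal.ofReal A := by
          refine liminf_le_of_le (by isBoundedDefault) fun b hb => ?_
          obtain ⟨n, hn⟩ := hb.exists
          refine hn.trans ?_
          rw [← ofReal_integral_eq_lintegral_ofReal (hint n)
            (ae_of_all _ fun s => (one_div_pos.2 (hpos n s)).le)]
          exact ENNReal.ofReal_le_ofReal (hle n)
  have hmeas : Measurable fun s : unitInterval => (ENNReal.ofReal s)⁻¹ := by fun_prop
  -- No atom at `s = 0`, that is, at `t = ∞`.
  have hne : ∀ᵐ s : unitInterval ∂ν, 0 < (s : ℝ) := by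
    filter_upwards [ae_lt_top hmeas (hlint.trans_lt ENNReal.ofReal_lt_top).ne] with s hs
    simpa using hs
  have hinv : Integrable (fun s : unitInterval => 1 / (s : ℝ)) ν := by
    refine ⟨(by fun_prop : Measurable fun s : unitInterval =>
      1 / (s : ℝ)).aestronglyMeasurable, ?_⟩
    refine lt_of_le_of_lt (lintegral_mono_ae ?_) (hlint.trans_lt ENNReal.ofReal_lt_top)
    filter_upwards [hne] with s hs
    rw [one_div, enorm_inv hs.ne', Real.enorm_eq_ofReal hs.le]
  have ha : ∫ s : unitInterval, 1 / (s : ℝ) ∂ν ≤ A := by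
    have hA : 0 ≤ A := le_trans (integral_nonneg fun s => (one_div_pos.2 (hpos 0 s)).le) (hle 0)
    rw [integral_eq_lintegral_of_nonneg_ae (ae_of_all _ fun s => one_div_nonneg.2 s.2.1)
      hinv.aestronglyMeasurable]
    refine ENNReal.toReal_le_of_le_ofReal hA (le_trans (lintegral_mono_ae ?_) hlint)
    filter_upwards [hne] with s hs
    rw [one_div, ENNReal.ofReal_inv_of_pos hs]
  -- With `t = (1 - s) / s` one has `1 / s - (x - 1) / (x s + 1 - s) = s⁻² / (x + t)`. This dictates
  -- the density, the change of variable and the constant `A - ∫ 1 / s`.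
  set d : unitInterval → NNReal := fun s => (1 / (s : ℝ) ^ 2).toNNReal with hd
  have hdm : Measurable d := by fun_prop
  have hdv : ∀ s, (d s : ℝ) = 1 / (s : ℝ) ^ 2 := fun s => Real.coe_toNNReal _ (by positivity)
  set T : unitInterval → ℝ := fun s => (1 - s) / s with hT
  have hTm : Measurable T := by fun_prop
  have hT0 : ∀ s, 0 ≤ T s := fun s => div_nonneg (by linarith [s.2.2]) s.2.1
  have hrestr : ((ν.withDensity fun s => (d s : ENNReal)).map T).restrict (Set.Ici 0) =
      (ν.withDensity fun s => (d s : ENNReal)).map T := by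
    refine Measure.restrict_eq_self_of_ae_mem ?_
    exact (ae_map_iff (p := fun t => t ∈ Set.Ici (0 : ℝ)) hTm.aemeasurable measurableSet_Ici).2
      (ae_of_all _ hT0)
  have hkm : ∀ x : ℝ, Measurable fun t : ℝ => 1 / (x + t) := fun x => by fun_prop
  refine ⟨A - ∫ s : unitInterval, 1 / (s : ℝ) ∂ν, sub_nonneg.2 ha,
    (ν.withDensity fun s => (d s : ENNReal)).map T, ?_, fun x hx => ?_⟩
  · rw [IntegrableOn, hrestr, integrable_map_measure (hkm 1).aestronglyMeasurable hTm.aemeasurable,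
      integrable_withDensity_iff_integrable_smul hdm]
    refine hinv.congr ?_
    filter_upwards [hne] with s hs
    rw [NNReal.smul_def, hdv, smul_eq_mul, Function.comp_apply, hT]
    field_simp
    ring
  · rw [hrestr, integral_map hTm.aemeasurable (hkm x).aestronglyMeasurable,
      integral_withDensity_eq_integral_smul hdm, hν x hx]
    have hden : ∀ s : unitInterval, 0 < x * s + (1 - s) := by
      intro s
      rcases s with ⟨s, hs0, hs1⟩
      rcases eq_or_lt_of_le hs0 with h | h
      · simp [← h]
      · have : 0 < x * s := by positivity
        simp only; linarith
    have hkc : Continuous fun s : unitInterval => (x - 1) / (x * s + (1 - s)) :=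
      Continuous.div continuous_const (by fun_prop) fun s => (hden s).ne'
    have hki : Integrable (fun s : unitInterval => (x - 1) / (x * s + (1 - s))) ν :=
      (BoundedContinuousFunction.mkOfCompact ⟨_, hkc⟩).integrable ν
    have heq : ∫ s : unitInterval, d s • (1 / (x + T s)) ∂ν =
        ∫ s : unitInterval, (1 / (s : ℝ) - (x - 1) / (x * s + (1 - s))) ∂ν := by
      refine integral_congr_ae ?_
      filter_upwards [hne] with s hs
      have h1 := hden s
      have h2 : x + T s = (x * s + (1 - s)) / s := by
        simp only [hT]; field_simp
      rw [NNReal.smul_def, hdv, smul_eq_mul, h2, div_sub_div _ _ hs.ne' h1.ne', one_div_div,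
        div_mul_div_comm, div_eq_div_iff (by positivity) (by positivity)]
      ring
    rw [heq, integral_sub hinv hki]
    ring

open Complex MeasureTheory Filter Topology in
/-- A holomorphic function on the slit plane that is nonnegative on the positive half line and
whose imaginary part has the opposite sign to that of its argument is a Stieltjes function. -/
theorem isStieltjes_of_im_mul_im_nonpos {f : ℂ → ℂ} (hf : DifferentiableOn ℂ f slitPlane)
    (hpos : ∀ x : ℝ, 0 < x → 0 ≤ (f x).re)
    (him : ∀ z ∈ slitPlane, z.im * (f z).im ≤ 0) : IsStieltjes fun x => (f x).re := by
  set r : ℕ → ℝ := fun n => 1 - 1 / ((n : ℝ) + 2) with hr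
  have hr0 : ∀ n, 0 < r n := fun n => by
    have : 1 / ((n : ℝ) + 2) < 1 := by rw [div_lt_one (by positivity)]; linarith
    simp only [hr]; linarith
  have hr1 : ∀ n, r n < 1 := fun n => by
    have : 0 < 1 / ((n : ℝ) + 2) := by positivity
    simp only [hr]; linarith
  have hrlim : Tendsto r atTop (𝓝 1) := by
    have h1 : Tendsto (fun n : ℕ => (n : ℝ) + 2) atTop atTop :=
      tendsto_atTop_add_const_right _ _ tendsto_natCast_atTop_atTop
    simpa [hr] using tendsto_const_nhds.sub (h1.const_div_atTop 1)
  choose ν hν using fun n => exists_finiteMeasure_dilation hf him (hr0 n) (hr1 n)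
  have hden : ∀ x : ℝ, 0 < x → ∀ s : unitInterval, 0 < x * s + (1 - s) := by
    intro x hx s
    rcases s with ⟨s, hs0, hs1⟩
    rcases eq_or_lt_of_le hs0 with h | h
    · simp [← h]
    · have : 0 < x * s := by positivity
      simp only; linarith
  have hkc : ∀ x : ℝ, 0 < x → Continuous fun s : unitInterval => (x - 1) / (x * s + (1 - s)) :=
    fun x hx => Continuous.div continuous_const (by fun_prop) fun s => (hden x hx s).ne'
  have hinv : ∀ x : ℝ, 0 < x → ∃ w : ℝ, |w| < 1 ∧ x = ((1 + w) / (1 - w)) ^ 2 := by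
    intro x hx
    have hs := Real.sqrt_pos.2 hx
    refine ⟨(√x - 1) / (√x + 1), ?_, ?_⟩
    · rw [abs_lt, lt_div_iff₀ (by positivity), div_lt_iff₀ (by positivity)]
      constructor <;> linarith
    · have h1 : (1 + (√x - 1) / (√x + 1)) / (1 - (√x - 1) / (√x + 1)) = √x := by
        field_simp; ring
      rw [h1, Real.sq_sqrt hx.le]
  have hreal : ∀ w : ℝ, discToSlitPlane w = ((((1 + w) / (1 - w)) ^ 2 : ℝ) : ℂ) := by
    intro w; simp [discToSlitPlane]
  -- At `x = 2` the kernel `1 / (1 + s)` is at least `1 / 2`, while the dilated function is still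
  -- nonnegative.
  have hmass : ∀ n, (ν n).mass ≤ (2 * (f 1).re).toNNReal := by
    intro n
    obtain ⟨w, hw, hx⟩ := hinv 2 two_pos
    have h1 := hν n w 2 hw hx
    have hrw : |r n * w| < 1 := by
      rw [abs_mul, abs_of_pos (hr0 n)]; nlinarith [abs_nonneg w, hr0 n, hr1 n]
    have h2 : 0 ≤ (f (discToSlitPlane (r n * w))).re := by
      rw [← ofReal_mul, hreal]
      refine hpos _ ?_
      have := abs_lt.1 hrw
      have h3 : 0 < 1 + r n * w := by linarith
      have h4 : 0 < 1 - r n * w := by linarith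
      positivity
    have h3 : ∫ _ : unitInterval, (1 / 2 : ℝ) ∂(ν n : Measure unitInterval) ≤
        ∫ s : unitInterval, ((2 : ℝ) - 1) / (2 * s + (1 - s)) ∂(ν n : Measure unitInterval) := by
      refine integral_mono (integrable_const _)
        ((BoundedContinuousFunction.mkOfCompact ⟨_, hkc 2 two_pos⟩).integrable _) fun s => ?_
      beta_reduce
      rw [div_le_div_iff₀ two_pos (hden 2 two_pos s)]
      linarith [s.2.2]
    rw [integral_const, smul_eq_mul] at h3
    rw [← NNReal.coe_le_coe]
    refine le_trans ?_ (Real.le_coe_toNNReal _)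
    have h4 : ((ν n).mass : ℝ) = (ν n : Measure unitInterval).real Set.univ := rfl
    rw [h4]
    linarith
  obtain ⟨μ, hμ⟩ := exists_finiteMeasure_integral_eq_of_tendsto _ ν hmass
  refine isStieltjes_of_finiteMeasure hpos (A := (f 1).re) (μ : Measure unitInterval) ?_
  intro x hx
  obtain ⟨w, hw, hxw⟩ := hinv x hx
  have hwn : ‖(w : ℂ)‖ < 1 := by simpa using hw
  have h1 := hμ ⟨_, hkc x hx⟩ ((f 1).re - (f x).re) (by
    have h2 : Tendsto (fun n => discToSlitPlane (r n * w)) atTop (𝓝 (discToSlitPlane w)) := by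
      refine (differentiableAt_discToSlitPlane hwn).continuousAt.tendsto.comp ?_
      have h3 : Tendsto (fun n => ((r n : ℝ) : ℂ) * w) atTop (𝓝 (((1 : ℝ) : ℂ) * w)) :=
        ((continuous_ofReal.tendsto 1).comp hrlim).mul_const _
      simpa using h3
    have h4 : Tendsto (fun n => (f (discToSlitPlane (r n * w))).re) atTop (𝓝 (f x).re) := by
      have h5 : discToSlitPlane w = x := by rw [hreal, ← hxw]
      rw [← h5]
      refine (continuous_re.tendsto _).comp (Tendsto.comp ?_ h2)
      exact (hf.differentiableAt
        (isOpen_slitPlane.mem_nhds (discToSlitPlane_mem hwn))).continuousAt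
    refine (tendsto_const_nhds.sub h4).congr fun n => ?_
    rw [hν n w x hw hxw]
    simp)
  simp only [ContinuousMap.coe_mk] at h1
  rw [h1]
  ring

/-! ### Reflection, and criteria on one half-plane. -/

open Complex ComplexConjugate Filter Topology in
/-- The Schwarz reflection principle on the slit plane. -/
theorem conj_eq_of_real_on_pos {f : ℂ → ℂ} (hf : DifferentiableOn ℂ f slitPlane)
    (hreal : ∀ x : ℝ, 0 < x → (f x).im = 0) {z : ℂ} (hz : z ∈ slitPlane) :
    f (conj z) = conj (f z) := by
  have hmem : ∀ z ∈ slitPlane, conj z ∈ slitPlane := by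
    intro z hz
    rw [mem_slitPlane_iff] at *
    simpa using hz
  have hg : DifferentiableOn ℂ (fun z => conj (f (conj z))) slitPlane := by
    intro z hz
    have h1 := (hf.differentiableAt (isOpen_slitPlane.mem_nhds (hmem z hz))).conj_conj
    rw [conj_conj] at h1
    exact h1.differentiableWithinAt
  have hpc : IsPreconnected slitPlane :=
    (starConvex_one_slitPlane.isPathConnected one_mem_slitPlane).isConnected.isPreconnected
  have heq := AnalyticOnNhd.eqOn_of_preconnected_of_frequently_eq
    (hg.analyticOnNhd isOpen_slitPlane) (hf.analyticOnNhd isOpen_slitPlane) hpc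
    one_mem_slitPlane (by
      have h1 : Tendsto (fun x : ℝ => (x : ℂ)) (𝓝[≠] 1) (𝓝[≠] (1 : ℂ)) := by
        refine tendsto_nhdsWithin_iff.2 ⟨?_, ?_⟩
        · exact (by simpa using continuous_ofReal.tendsto 1 :
            Tendsto (fun x : ℝ => (x : ℂ)) (𝓝 1) (𝓝 1)).mono_left nhdsWithin_le_nhds
        · filter_upwards [self_mem_nhdsWithin] with x hx
          simpa using hx
      refine h1.frequently (Eventually.frequently ?_)
      filter_upwards [nhdsWithin_le_nhds (lt_mem_nhds one_pos)] with x hx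
      rw [conj_ofReal, conj_eq_iff_im]
      exact hreal x hx)
  have h2 := heq hz
  simp only at h2
  rw [← h2, conj_conj]

open Complex ComplexConjugate in
/-- A holomorphic function on the slit plane that is nonnegative on the positive half line and
maps the upper half plane to the closed lower half plane is a Stieltjes function. -/
theorem isStieltjes_of_upper {f : ℂ → ℂ} {g : ℝ → ℝ} (hf : DifferentiableOn ℂ f slitPlane)
    (hfg : ∀ x : ℝ, 0 < x → f x = g x) (hg : ∀ x, 0 < x → 0 ≤ g x)
    (him : ∀ z : ℂ, 0 < z.im → (f z).im ≤ 0) : IsStieltjes g := by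
  have hr : ∀ x : ℝ, 0 < x → (f x).im = 0 := fun x hx => by rw [hfg x hx, ofReal_im]
  obtain ⟨a, ha, μ, h1, h2⟩ := isStieltjes_of_im_mul_im_nonpos hf
    (fun x hx => by rw [hfg x hx, ofReal_re]; exact hg x hx) (by
      intro z hz
      rcases lt_trichotomy z.im 0 with h | h | h
      · have h1 := him (conj z) (by simpa using h)
        rw [conj_eq_of_real_on_pos hf hr hz, conj_im] at h1
        exact mul_nonpos_of_nonpos_of_nonneg h.le (by linarith)
      · simp [h]
      · exact mul_nonpos_of_nonneg_of_nonpos h.le (him z h))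
  exact ⟨a, ha, μ, h1, fun x hx => by
    rw [← h2 x hx]; simp only [hfg x hx, ofReal_re]⟩

open Complex ComplexConjugate in
/-- A holomorphic function on the slit plane that is nonnegative on the positive half line and
maps the lower half plane to the closed upper half plane is a Stieltjes function. -/
theorem isStieltjes_of_lower {f : ℂ → ℂ} {g : ℝ → ℝ} (hf : DifferentiableOn ℂ f slitPlane)
    (hfg : ∀ x : ℝ, 0 < x → f x = g x) (hg : ∀ x, 0 < x → 0 ≤ g x)
    (him : ∀ z : ℂ, z.im < 0 → 0 ≤ (f z).im) : IsStieltjes g := by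
  refine isStieltjes_of_upper hf hfg hg fun z hz => ?_
  have h1 := him (conj z) (by simpa using hz)
  rw [conj_eq_of_real_on_pos hf (fun x hx => by rw [hfg x hx, ofReal_im])
    (Or.inr hz.ne'), conj_im] at h1
  linarith

/-! ### The Wright omega function on the strip. -/

open Complex in
/-- The map `w ↦ w + log w`, inverse to the Wright omega function. -/
noncomputable def addLog (w : ℂ) : ℂ := w + log w

open Complex in
theorem addLog_im (w : ℂ) : (addLog w).im = w.im + w.arg := by simp [addLog, log_im]

open Complex in
theorem addLog_re (w : ℂ) : (addLog w).re = w.re + Real.log ‖w‖ := by simp [addLog, log_re]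

open Complex in
theorem arg_pos_of_im_pos {w : ℂ} (hw : 0 < w.im) : 0 < w.arg := by
  refine lt_of_le_of_ne (arg_nonneg_iff.2 hw.le) fun h => ?_
  exact hw.ne' (arg_eq_zero_iff.1 h.symm).2

open Complex in
theorem addLog_im_pos {w : ℂ} (hw : 0 < w.im) : 0 < (addLog w).im := by
  rw [addLog_im]; linarith [arg_pos_of_im_pos hw]

open Complex in
theorem addLog_im_neg {w : ℂ} (hw : w.im < 0) : (addLog w).im < 0 := by
  rw [addLog_im]; linarith [arg_neg_iff.2 hw]

open Complex in
theorem addLog_ofReal {u : ℝ} (hu : 0 < u) : addLog u = ((u + Real.log u : ℝ) : ℂ) := by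
  simp [addLog, ofReal_log hu.le]

open Complex in
theorem eq_ofReal_of_mem_slitPlane {w : ℂ} (hw : w ∈ slitPlane) (h : w.im = 0) :
    0 < w.re ∧ w = (w.re : ℂ) := by
  refine ⟨hw.resolve_right (by simpa using h), ?_⟩
  apply Complex.ext <;> simp [h]

open Complex in
theorem hasStrictDerivAt_addLog {w : ℂ} (hw : w ∈ slitPlane) :
    HasStrictDerivAt addLog (1 + w⁻¹) w :=
  (hasStrictDerivAt_id w).add (hasStrictDerivAt_log hw)

-- Along the segment from `w₁` to `w₂` the difference quotient has derivative with imaginary part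
-- `Im (1 / w) < 0`, so equal end values contradict the mean value theorem.
open Complex in
theorem addLog_injOn_upper {w₁ w₂ : ℂ} (h₁ : 0 < w₁.im) (h₂ : 0 < w₂.im)
    (h : addLog w₁ = addLog w₂) : w₁ = w₂ := by
  by_contra hne
  have hd : w₂ - w₁ ≠ 0 := sub_ne_zero.2 (Ne.symm hne)
  have him : ∀ t ∈ Set.Icc (0 : ℝ) 1, 0 < (w₁ + t * (w₂ - w₁)).im := by
    intro t ht
    have : (w₁ + t * (w₂ - w₁)).im = (1 - t) * w₁.im + t * w₂.im := by simp; ring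
    rw [this]
    rcases eq_or_lt_of_le ht.1 with h0 | h0
    · simp [← h0, h₁]
    · have := mul_pos h0 h₂
      have := mul_nonneg (sub_nonneg.2 ht.2) h₁.le
      linarith
  have hder : ∀ t ∈ Set.Icc (0 : ℝ) 1, HasDerivAt
      (fun t : ℝ => (addLog (w₁ + t * (w₂ - w₁)) / (w₂ - w₁)).im)
      ((w₁ + t * (w₂ - w₁))⁻¹).im t := by
    intro t ht
    have h1 := (hasStrictDerivAt_addLog (Or.inr (him t ht).ne')).hasDerivAt
    have h2 : HasDerivAt (fun t : ℂ => w₁ + t * (w₂ - w₁)) (w₂ - w₁) (t : ℂ) := by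
      simpa using ((hasDerivAt_id (t : ℂ)).mul_const (w₂ - w₁)).const_add w₁
    have h3 := ((h1.comp (t : ℂ) h2).div_const (w₂ - w₁)).comp_ofReal
    have h4 := (imCLM.hasFDerivAt.comp_hasDerivAt t h3)
    rw [mul_div_cancel_right₀ _ hd] at h4
    simpa using! h4
  obtain ⟨c, hc, hc'⟩ := exists_hasDerivAt_eq_slope _ _ one_pos
    (fun t ht => (hder t ht).continuousAt.continuousWithinAt)
    (fun t ht => hder t (Set.Ioo_subset_Icc_self ht))
  have h5 := him c (Set.Ioo_subset_Icc_self hc)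
  have h6 : ((w₁ + c * (w₂ - w₁))⁻¹).im < 0 := by
    rw [inv_im]
    refine div_neg_of_neg_of_pos (by linarith) (normSq_pos.2 fun h => ?_)
    rw [h] at h5; simp at h5
  rw [hc'] at h6
  simp [h] at h6

open Complex ComplexConjugate in
theorem addLog_conj {w : ℂ} (hw : w ∈ slitPlane) : addLog (conj w) = conj (addLog w) := by
  simp [addLog, log_conj w (slitPlane_arg_ne_pi hw)]

-- `addLog` preserves the sign of the imaginary part, so the two half-planes and the positive axis
-- can be treated separately: conjugation handles the lower one and monotonicity the axis.
open Complex ComplexConjugate in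
theorem addLog_injOn : Set.InjOn addLog slitPlane := by
  intro w₁ h₁ w₂ h₂ h
  have hsign : ∀ w ∈ slitPlane, (0 < w.im ↔ 0 < (addLog w).im) ∧
      (w.im < 0 ↔ (addLog w).im < 0) := by
    intro w hw
    rcases lt_trichotomy w.im 0 with h0 | h0 | h0
    · have := addLog_im_neg h0
      constructor <;> constructor <;> intro <;> linarith
    · have : (addLog w).im = 0 := by
        obtain ⟨h1, h2⟩ := eq_ofReal_of_mem_slitPlane hw h0
        rw [h2, addLog_ofReal h1, ofReal_im]
      simp [h0, this]
    · have := addLog_im_pos h0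
      constructor <;> constructor <;> intro <;> linarith
  obtain ⟨p₁, n₁⟩ := hsign w₁ h₁
  obtain ⟨p₂, n₂⟩ := hsign w₂ h₂
  rw [h] at p₁ n₁
  rcases lt_trichotomy w₁.im 0 with h0 | h0 | h0
  · have h3 : addLog (conj w₁) = addLog (conj w₂) := by
      rw [addLog_conj h₁, addLog_conj h₂, h]
    have h4 := addLog_injOn_upper (by simpa using h0) (by simpa using n₂.2 (n₁.1 h0)) h3
    exact (starRingEnd ℂ).injective h4
  · have h0' : w₂.im = 0 := by
      refine le_antisymm (not_lt.1 fun h3 => ?_) (not_lt.1 fun h3 => ?_)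
      · exact absurd (p₁.2 (p₂.1 h3)) (by linarith)
      · exact absurd (n₁.2 (n₂.1 h3)) (by linarith)
    obtain ⟨a₁, b₁⟩ := eq_ofReal_of_mem_slitPlane h₁ h0
    obtain ⟨a₂, b₂⟩ := eq_ofReal_of_mem_slitPlane h₂ h0'
    rw [b₁, b₂, addLog_ofReal a₁, addLog_ofReal a₂, ofReal_inj] at h
    rw [b₁, b₂, ofReal_inj]
    rcases lt_trichotomy w₁.re w₂.re with h3 | h3 | h3
    · have := Real.log_lt_log a₁ h3; linarith
    · exact h3
    · have := Real.log_lt_log a₂ h3; linarith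
  · exact addLog_injOn_upper h0 (p₂.2 (p₁.1 h0)) h

open Complex in
theorem one_add_inv_ne_zero_of_mem_slitPlane {w : ℂ} (hw : w ∈ slitPlane) : 1 + w⁻¹ ≠ 0 := by
  intro h
  have h1 : w⁻¹ = -1 := by linear_combination h
  have h2 : w = -1 := by rw [← inv_inv w, h1]; norm_num
  rw [h2, mem_slitPlane_iff] at hw
  norm_num at hw

open Complex Filter Topology in
theorem isOpen_image_addLog : IsOpen (addLog '' slitPlane) := by
  rw [isOpen_iff_mem_nhds]
  rintro _ ⟨w, hw, rfl⟩
  rw [← (hasStrictDerivAt_addLog hw).map_nhds_eq (one_add_inv_ne_zero_of_mem_slitPlane hw)]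
  exact image_mem_map (isOpen_slitPlane.mem_nhds hw)

-- Unlike `arg`, the absolute value `|arg|` is continuous across the cut, as the right side shows.
open Complex in
theorem abs_arg_eq_arccos {w : ℂ} (hw : w ≠ 0) : |w.arg| = Real.arccos (w.re / ‖w‖) := by
  rw [← cos_arg hw, ← Real.cos_abs, Real.arccos_cos (abs_nonneg _) (abs_arg_le_pi w)]

-- The strip is connected and the image is open, so it is enough that the image be closed relative
-- to the strip. Preimages of a convergent sequence stay bounded and away from `0`. They cannot
-- accumulate on the cut, because `|Im (addLog w)| ≥ |arg w|` would push the limit out of the strip.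
open Complex Filter Topology in
theorem strip_subset_image_addLog :
    {y : ℂ | |y.im| < Real.pi} ⊆ addLog '' slitPlane := by
  have hconv : Convex ℝ {y : ℂ | |y.im| < Real.pi} := by
    have : {y : ℂ | |y.im| < Real.pi} = imLm ⁻¹' (Set.Ioo (-Real.pi) Real.pi) := by
      ext y; simp [abs_lt]
    rw [this]
    exact (convex_Ioo _ _).linear_preimage _
  refine hconv.isPreconnected.subset_of_closure_inter_subset isOpen_image_addLog ?_ ?_
  · refine ⟨addLog 1, ?_, 1, one_mem_slitPlane, rfl⟩
    simp [addLog, Real.pi_pos]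
  rintro y ⟨hy, hys⟩
  obtain ⟨v, hv, hvy⟩ := mem_closure_iff_seq_limit.1 hy
  choose w hw hwv using hv
  obtain rfl : (fun n => addLog (w n)) = v := funext hwv
  obtain ⟨C, hC⟩ := hvy.norm.bddAbove_range
  have hC' : ∀ n, ‖addLog (w n)‖ ≤ C := fun n => hC ⟨n, rfl⟩
  have hw0 : ∀ n, w n ≠ 0 := fun n => slitPlane_ne_zero (hw n)
  have hnp : ∀ n, 0 < ‖w n‖ := fun n => norm_pos_iff.2 (hw0 n)
  have hbd : ∀ n, ‖w n‖ ≤ 2 * (C + Real.pi) + 1 := by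
    intro n
    by_contra! hn
    have hC0 : 0 ≤ C := (norm_nonneg _).trans (hC' n)
    have h1 : 1 ≤ ‖w n‖ := by linarith [Real.pi_pos]
    have h2 : ‖w n‖ ≤ ‖addLog (w n)‖ + ‖log (w n)‖ := by
      have : w n = addLog (w n) - log (w n) := by simp [addLog]
      conv_lhs => rw [this]
      exact norm_sub_le _ _
    have h3 : ‖log (w n)‖ ≤ Real.log ‖w n‖ + Real.pi := by
      refine (norm_le_abs_re_add_abs_im _).trans (add_le_add ?_ ?_)
      · rw [log_re, abs_of_nonneg (Real.log_nonneg h1)]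
      · rw [log_im]; exact abs_arg_le_pi _
    -- Apply `log u ≤ u - 1` at `u = ‖w n‖ / 2`, with `log 2 < 1`.
    have h4 : Real.log ‖w n‖ ≤ ‖w n‖ / 2 := by
      have h5 := Real.log_le_sub_one_of_pos (half_pos (hnp n))
      rw [Real.log_div (hnp n).ne' two_ne_zero] at h5
      have := Real.log_two_lt_d9
      linarith
    linarith [hC' n]
  set R := 2 * (C + Real.pi) + 1 with hR
  have hlow : ∀ n, Real.exp (-(C + R)) ≤ ‖w n‖ := by
    intro n
    rw [← Real.le_log_iff_exp_le (hnp n)]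
    have h1 : |(addLog (w n)).re| ≤ C := (abs_re_le_norm _).trans (hC' n)
    have h2 : |(w n).re| ≤ R := (abs_re_le_norm _).trans (hbd n)
    rw [addLog_re] at h1
    linarith [(abs_le.1 h1).1, (abs_le.1 h2).2]
  obtain ⟨z, -, φ, hφ, hz⟩ := (isCompact_closedBall (0 : ℂ) R).tendsto_subseq
    (x := w) (fun n => by simpa using hbd n)
  have hz0 : z ≠ 0 := by
    have h1 : Real.exp (-(C + R)) ≤ ‖z‖ :=
      ge_of_tendsto hz.norm (Eventually.of_forall fun n => hlow _)
    exact norm_pos_iff.1 ((Real.exp_pos _).trans_le h1)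
  have hy' := hvy.comp hφ.tendsto_atTop
  by_cases hzs : z ∈ slitPlane
  · refine ⟨z, hzs, tendsto_nhds_unique ?_ hy'⟩
    exact (hasStrictDerivAt_addLog hzs).hasDerivAt.continuousAt.tendsto.comp hz
  · exfalso
    rw [mem_slitPlane_iff, not_or, not_not, not_lt] at hzs
    have h1 : Tendsto (fun n => |((w ∘ φ) n).arg|) atTop (𝓝 |z.arg|) := by
      simp only [abs_arg_eq_arccos hz0, Function.comp_apply, abs_arg_eq_arccos (hw0 _)]
      refine (Real.continuous_arccos.tendsto _).comp ?_
      exact ((continuous_re.tendsto z).comp hz).div hz.norm (norm_ne_zero_iff.2 hz0)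
    have h2 : |z.arg| = Real.pi := by
      have hre : z.re < 0 := lt_of_le_of_ne hzs.1 fun h => hz0 (Complex.ext h hzs.2)
      rw [arg_eq_pi_iff.2 ⟨hre, hzs.2⟩, abs_of_pos Real.pi_pos]
    have h3 : Tendsto (fun n => |(addLog ((w ∘ φ) n)).im|) atTop (𝓝 |y.im|) :=
      ((continuous_im.tendsto y).comp hy').abs
    have h4 : |z.arg| ≤ |y.im| := le_of_tendsto_of_tendsto' h1 h3 fun n => by
      generalize (w ∘ φ) n = u
      rw [addLog_im]
      rcases lt_or_ge u.im 0 with h | h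
      · have h5 := arg_neg_iff.2 h
        rw [abs_of_neg h5, abs_of_neg (by linarith)]; linarith
      · have h5 := arg_nonneg_iff.2 h
        rw [abs_of_nonneg h5, abs_of_nonneg (by linarith)]; linarith
    rw [h2] at h4
    exact absurd hys (not_lt.2 h4)

open Complex in
/-- The Wright omega function, the inverse of `w ↦ w + log w` on the slit plane. -/
noncomputable def wrightOmega (y : ℂ) : ℂ := Function.invFunOn addLog slitPlane y

open Complex in
theorem wrightOmega_mem {y : ℂ} (hy : |y.im| < Real.pi) : wrightOmega y ∈ slitPlane :=
  Function.invFunOn_mem (strip_subset_image_addLog hy)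

open Complex in
theorem addLog_wrightOmega {y : ℂ} (hy : |y.im| < Real.pi) : addLog (wrightOmega y) = y :=
  Function.invFunOn_eq (strip_subset_image_addLog hy)

-- `wrightOmega` is defined by choice; injectivity of `addLog` identifies it near `y` with the
-- holomorphic local inverse.
open Complex Filter Topology in
theorem differentiableAt_wrightOmega {y : ℂ} (hy : |y.im| < Real.pi) :
    DifferentiableAt ℂ wrightOmega y := by
  have hw := wrightOmega_mem hy
  have hs := hasStrictDerivAt_addLog hw
  have h0 := one_add_inv_ne_zero_of_mem_slitPlane hw
  have h1 := hs.to_localInverse h0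
  have hr := hs.eventually_right_inverse h0
  have hl := hs.hasStrictFDerivAt_equiv h0 |>.localInverse_apply_image
  rw [addLog_wrightOmega hy] at h1 hr hl
  refine h1.hasDerivAt.differentiableAt.congr_of_eventuallyEq ?_
  have hstrip : ∀ᶠ x in 𝓝 y, |x.im| < Real.pi :=
    (isOpen_lt (continuous_im.abs) continuous_const).mem_nhds hy
  have hmem : ∀ᶠ x in 𝓝 y,
      HasStrictDerivAt.localInverse addLog (1 + (wrightOmega y)⁻¹) (wrightOmega y) hs h0 x
        ∈ slitPlane := by
    refine h1.hasDerivAt.continuousAt.eventually_mem (isOpen_slitPlane.mem_nhds ?_)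
    exact Set.mem_of_eq_of_mem hl hw
  filter_upwards [hstrip, hmem, hr] with x hx1 hx2 hx3
  exact addLog_injOn (wrightOmega_mem hx1) hx2 ((addLog_wrightOmega hx1).trans hx3.symm)

open Complex in
theorem wrightOmega_im_pos {y : ℂ} (hy : |y.im| < Real.pi) (h : 0 < y.im) :
    0 < (wrightOmega y).im := by
  by_contra! hn
  have h1 := addLog_wrightOmega hy
  rcases hn.lt_or_eq with h2 | h2
  · have := addLog_im_neg h2
    rw [h1] at this; linarith
  · obtain ⟨h3, h4⟩ := eq_ofReal_of_mem_slitPlane (wrightOmega_mem hy) h2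
    rw [h4, addLog_ofReal h3] at h1
    rw [← h1, ofReal_im] at h
    exact h.false

/-! ### Continuation of `W(x^β)` and the resulting criteria. -/

theorem lambertW_pos {x : ℝ} (hx : 0 < x) : 0 < lambertW x := by
  have h := (lambertW_eq_iff hx _).1 rfl
  by_contra! hn
  nlinarith [Real.exp_pos (lambertW x)]

theorem lambertW_mul_exp {x : ℝ} (hx : 0 < x) : lambertW x * Real.exp (lambertW x) = x :=
  (lambertW_eq_iff hx _).1 rfl

open Complex in
theorem wrightOmega_log {x : ℝ} (hx : 0 < x) :
    wrightOmega (Real.log x : ℝ) = lambertW x := by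
  have hy : |((Real.log x : ℝ) : ℂ).im| < Real.pi := by simp [Real.pi_pos]
  have hp := lambertW_pos hx
  refine addLog_injOn (wrightOmega_mem hy) (ofReal_mem_slitPlane.2 hp) ?_
  rw [addLog_wrightOmega hy, addLog_ofReal hp, ofReal_inj]
  conv_lhs => rw [← lambertW_mul_exp hx, Real.log_mul hp.ne' (Real.exp_pos _).ne', Real.log_exp]
  ring

open Complex in
theorem abs_im_mul_log_lt_pi {β : ℝ} (hβ : |β| ≤ 1) {z : ℂ} (hz : z ∈ slitPlane) :
    |(β * log z).im| < Real.pi := by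
  rw [im_ofReal_mul, log_im, abs_mul]
  have h1 : |z.arg| < Real.pi := by
    rw [abs_lt]
    exact ⟨neg_pi_lt_arg z, lt_of_le_of_ne (arg_le_pi z) (slitPlane_arg_ne_pi hz)⟩
  nlinarith [abs_nonneg z.arg, abs_nonneg β]

open Complex in
theorem wrightOmega_mul_log {β x : ℝ} (hx : 0 < x) :
    wrightOmega (β * log x) = lambertW (x ^ β) := by
  rw [← wrightOmega_log (Real.rpow_pos_of_pos hx β), Real.log_rpow hx, ofReal_mul,
    ofReal_log hx.le]

open Complex in
theorem differentiableOn_comp_wrightOmega {G : ℂ → ℂ} (hG : DifferentiableOn ℂ G slitPlane)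
    {β : ℝ} (hβ : |β| ≤ 1) :
    DifferentiableOn ℂ (fun z => G (wrightOmega (β * log z))) slitPlane := by
  intro z hz
  have hs := abs_im_mul_log_lt_pi hβ hz
  have h1 : DifferentiableAt ℂ (fun z => (β : ℂ) * log z) z :=
    (differentiableAt_log hz).const_mul _
  have h2 := (differentiableAt_wrightOmega hs).comp z h1
  have h3 := hG.differentiableAt (isOpen_slitPlane.mem_nhds (wrightOmega_mem hs))
  exact (DifferentiableAt.comp z (g := G) h3 h2).differentiableWithinAt

-- The conditions on `w` describe the values of `ω` on `0 < Im y < π`, the last one being `Im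
-- (addLog w) < π`. Real `y` must be allowed because `β = 0` produces it.
open Complex in
theorem comp_wrightOmega_im_nonneg {G : ℂ → ℂ} (hGr : ∀ u : ℝ, 0 < u → (G u).im = 0)
    (him : ∀ w : ℂ, 0 < w.im → 0 < w.arg → w.im + w.arg < Real.pi → 0 ≤ (G w).im) {y : ℂ}
    (hy0 : 0 ≤ y.im) (hy1 : |y.im| < Real.pi) : 0 ≤ (G (wrightOmega y)).im := by
  rcases hy0.lt_or_eq with h | h
  · have h1 := wrightOmega_im_pos hy1 h
    refine him _ h1 (arg_pos_of_im_pos h1) ?_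
    rw [← addLog_im, addLog_wrightOmega hy1]
    exact (abs_lt.1 hy1).2
  · have h1 : (y.re : ℂ) = y := by
      apply Complex.ext <;> simp only [ofReal_re, ofReal_im]; exact h
    have h2 := wrightOmega_log (Real.exp_pos y.re)
    rw [Real.log_exp, h1] at h2
    rw [h2, hGr _ (lambertW_pos (Real.exp_pos _))]

open Complex in
/-- Functions of `lambertW (x ^ β)` for `0 ≤ β ≤ 1` that are Stieltjes. -/
theorem isStieltjes_comp_lambertW {G : ℂ → ℂ} {g : ℝ → ℝ} {β : ℝ} (hβ0 : 0 ≤ β) (hβ1 : β ≤ 1)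
    (hG : DifferentiableOn ℂ G slitPlane) (hGg : ∀ u : ℝ, 0 < u → G u = g u)
    (hg : ∀ u, 0 < u → 0 ≤ g u)
    (him : ∀ w : ℂ, 0 < w.im → 0 < w.arg → w.im + w.arg < Real.pi → (G w).im ≤ 0) :
    IsStieltjes fun x => g (lambertW (x ^ β)) := by
  have hβ : |β| ≤ 1 := abs_le.2 ⟨by linarith, hβ1⟩
  refine isStieltjes_of_upper (differentiableOn_comp_wrightOmega hG hβ) (fun x hx => ?_)
    (fun x hx => hg _ (lambertW_pos (Real.rpow_pos_of_pos hx β))) fun z hz => ?_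
  · rw [wrightOmega_mul_log hx, hGg _ (lambertW_pos (Real.rpow_pos_of_pos hx β))]
  · have h := comp_wrightOmega_im_nonneg (G := fun w => -G w) (y := β * log z)
      (fun u hu => by rw [hGg u hu, neg_im, ofReal_im, neg_zero])
      (fun w h1 h2 h3 => by rw [neg_im]; linarith [him w h1 h2 h3])
      (by rw [im_ofReal_mul, log_im]; exact mul_nonneg hβ0 (arg_pos_of_im_pos hz).le)
      (abs_im_mul_log_lt_pi hβ (Or.inr hz.ne'))
    rw [neg_im] at h
    linarith

open Complex in
/-- Functions of `lambertW (x ^ β)` for `-1 ≤ β ≤ 0` that are Stieltjes. -/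
theorem isStieltjes_comp_lambertW_neg {G : ℂ → ℂ} {g : ℝ → ℝ} {β : ℝ} (hβ0 : -1 ≤ β)
    (hβ1 : β ≤ 0)
    (hG : DifferentiableOn ℂ G slitPlane) (hGg : ∀ u : ℝ, 0 < u → G u = g u)
    (hg : ∀ u, 0 < u → 0 ≤ g u)
    (him : ∀ w : ℂ, 0 < w.im → 0 < w.arg → w.im + w.arg < Real.pi → 0 ≤ (G w).im) :
    IsStieltjes fun x => g (lambertW (x ^ β)) := by
  have hβ : |β| ≤ 1 := abs_le.2 ⟨hβ0, by linarith⟩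
  refine isStieltjes_of_lower (differentiableOn_comp_wrightOmega hG hβ) (fun x hx => ?_)
    (fun x hx => hg _ (lambertW_pos (Real.rpow_pos_of_pos hx β))) fun z hz => ?_
  · rw [wrightOmega_mul_log hx, hGg _ (lambertW_pos (Real.rpow_pos_of_pos hx β))]
  -- For `β ≤ 0` it is the lower half-plane that `β log z` sends to the closed upper side of the
  -- strip.
  · exact comp_wrightOmega_im_nonneg (fun u hu => by rw [hGg u hu, ofReal_im]) him
      (by rw [im_ofReal_mul, log_im]
          exact mul_nonneg_of_nonpos_of_nonpos hβ1 (arg_neg_iff.2 hz).le)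
      (abs_im_mul_log_lt_pi hβ (Or.inr hz.ne))

theorem IsStieltjes.congr {f g : ℝ → ℝ} (hf : IsStieltjes f) (h : ∀ x, 0 < x → g x = f x) :
    IsStieltjes g := by
  obtain ⟨a, ha, μ, h1, h2⟩ := hf
  exact ⟨a, ha, μ, h1, fun x hx => (h x hx).trans (h2 x hx)⟩

/-! ### Arguments and signs of imaginary parts. -/

open Complex in
theorem cpow_im_eq {z : ℂ} (hz : z ≠ 0) (a : ℝ) :
    (z ^ (a : ℂ)).im = Real.exp (a * Real.log ‖z‖) * Real.sin (a * z.arg) := by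
  rw [cpow_def_of_ne_zero hz, exp_im, mul_comm (log z), re_ofReal_mul, im_ofReal_mul, log_re, log_im]

open Complex in
theorem exp_mul_cpow_im {z w : ℂ} (hz : z ≠ 0) (a b : ℝ) :
    (exp (b * w) * z ^ (a : ℂ)).im =
      Real.exp (b * w.re + a * Real.log ‖z‖) * Real.sin (b * w.im + a * z.arg) := by
  rw [cpow_def_of_ne_zero hz, ← exp_add, exp_im, mul_comm (log z), add_re, add_im, re_ofReal_mul,
    im_ofReal_mul, re_ofReal_mul, im_ofReal_mul, log_re, log_im]

open Complex in
theorem ofReal_add_mem_slitPlane {c : ℝ} (hc : 0 ≤ c) {w : ℂ} (hw : w ∈ slitPlane) :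
    (c : ℂ) + w ∈ slitPlane := by
  rw [mem_slitPlane_iff] at *
  rcases hw with h | h
  · left; simp; linarith
  · right; simpa using h

-- Moving to the right in the upper half-plane increases `cos (arg w) = Re w / ‖w‖`. The cases on
-- signs allow this to be checked by comparing squares.
open Complex in
theorem arg_ofReal_add_le {c : ℝ} (hc : 0 ≤ c) {w : ℂ} (hw : 0 < w.im) :
    0 < ((c : ℂ) + w).arg ∧ ((c : ℂ) + w).arg ≤ w.arg := by
  have him : ((c : ℂ) + w).im = w.im := by simp
  have hw0 : w ≠ 0 := fun h => by simp [h] at hw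
  have hcw0 : (c : ℂ) + w ≠ 0 := fun h => by rw [h] at him; simp at him; linarith
  refine ⟨arg_pos_of_im_pos (him ▸ hw), ?_⟩
  rw [arg_of_im_nonneg_of_ne_zero (by rw [him]; exact hw.le) hcw0,
    arg_of_im_nonneg_of_ne_zero hw.le hw0]
  refine Real.arccos_le_arccos ?_
  rw [div_le_div_iff₀ (norm_pos_iff.2 hw0) (norm_pos_iff.2 hcw0)]
  have hre : ((c : ℂ) + w).re = c + w.re := by simp
  rw [hre]
  have n1 : ‖(c : ℂ) + w‖ ^ 2 = (c + w.re) ^ 2 + w.im ^ 2 := by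
    rw [← normSq_eq_norm_sq, normSq_apply, him, hre]; ring
  have n2 : ‖w‖ ^ 2 = w.re ^ 2 + w.im ^ 2 := by
    rw [← normSq_eq_norm_sq, normSq_apply]; ring
  have p1 := norm_nonneg w
  have p2 := norm_nonneg ((c : ℂ) + w)
  rcases le_or_gt 0 w.re with h | h
  · refine abs_le_of_sq_le_sq' ?_ (by positivity) |>.2
    rw [mul_pow, mul_pow, n1, n2]
    have : 0 ≤ w.im ^ 2 * (c * (c + 2 * w.re)) := by positivity
    nlinarith
  · rcases le_or_gt 0 (c + w.re) with h' | h'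
    · exact (mul_nonpos_of_nonpos_of_nonneg h.le p2).trans (mul_nonneg h' p1)
    · have : -(c + w.re) * ‖w‖ ≤ -w.re * ‖(c : ℂ) + w‖ := by
        refine abs_le_of_sq_le_sq' ?_ (mul_nonneg (by linarith) p2) |>.2
        rw [mul_pow, mul_pow, n1, n2]
        have : 0 ≤ w.im ^ 2 * (c * (-(c + w.re) + -w.re)) :=
          mul_nonneg (sq_nonneg _) (mul_nonneg hc (by linarith))
        nlinarith
      linarith

open Complex in
theorem one_div_im_nonpos {z : ℂ} (hz : 0 ≤ z.im) : (1 / z).im ≤ 0 := by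
  rw [one_div, inv_im]
  exact div_nonpos_of_nonpos_of_nonneg (by linarith) (normSq_nonneg z)

open Complex in
theorem differentiableOn_const_add_cpow (c a : ℝ) (hc : 0 ≤ c) :
    DifferentiableOn ℂ (fun w : ℂ => ((c : ℂ) + w) ^ (a : ℂ)) slitPlane := fun _ hw =>
  ((differentiableAt_id.const_add (c : ℂ)).cpow_const
    (ofReal_add_mem_slitPlane hc hw)).differentiableWithinAt

/-! ### The elementary functions `G`. -/

open Complex in
theorem isStieltjes_one_div_add_lambertW_rpow {c α : ℝ} (hc : 0 ≤ c) (h0 : 0 ≤ α) (h1 : α ≤ 1) :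
    IsStieltjes fun x => 1 / (c + lambertW (x ^ α)) := by
  refine isStieltjes_comp_lambertW (G := fun w => 1 / (c + w)) (g := fun u => 1 / (c + u)) h0 h1
    ?_ ?_ ?_ ?_
  · intro w hw
    exact (DifferentiableAt.div (by fun_prop) (by fun_prop)
      (slitPlane_ne_zero (ofReal_add_mem_slitPlane hc hw))).differentiableWithinAt
  · intro u _; push_cast; rfl
  · intro u hu; positivity
  · intro w hw _ _
    exact one_div_im_nonpos (by simpa using hw.le)

open Complex in
theorem isStieltjes_add_lambertW_rpow {c β : ℝ} (hc : 0 ≤ c) (h0 : -1 ≤ β) (h1 : β ≤ 0) :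
    IsStieltjes fun x => c + lambertW (x ^ β) := by
  refine isStieltjes_comp_lambertW_neg (G := fun w => c + w) (g := fun u => c + u) h0 h1
    (by fun_prop) ?_ ?_ ?_
  · intro u _; push_cast; rfl
  · intro u hu; positivity
  · intro w hw _ _
    simpa using hw.le

open Complex in
theorem isStieltjes_lambertW_inv_rpow {α : ℝ} (h0 : 0 ≤ α) (h1 : α ≤ 1) :
    IsStieltjes fun x => lambertW (x ^ (-1 : ℝ)) ^ α := by
  refine isStieltjes_comp_lambertW_neg (G := fun w => w ^ (α : ℂ)) (g := fun u => u ^ α) le_rfl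
    (by norm_num) ?_ ?_ ?_ ?_
  · intro w hw
    exact (differentiableAt_id.cpow_const hw).differentiableWithinAt
  · intro u hu; exact (ofReal_cpow hu.le α).symm
  · intro u hu; positivity
  · intro w hw ha hs
    rw [cpow_im_eq (fun h => by simp [h] at hw)]
    refine mul_nonneg (Real.exp_pos _).le (Real.sin_nonneg_of_nonneg_of_le_pi (by positivity) ?_)
    nlinarith

open Complex in
/-- `exp (a W(x^β)) (1 + W(x^β)) ^ b` for exponents `0 ≤ a, b ≤ 1`. -/
theorem isStieltjes_exp_mul_one_add_rpow {a b β : ℝ} (hβ0 : -1 ≤ β) (hβ1 : β ≤ 0)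
    (ha0 : 0 ≤ a) (ha1 : a ≤ 1) (hb0 : 0 ≤ b) (hb1 : b ≤ 1) :
    IsStieltjes fun x => Real.exp (a * lambertW (x ^ β)) * (1 + lambertW (x ^ β)) ^ b := by
  refine isStieltjes_comp_lambertW_neg
    (G := fun w => exp (a * w) * (((1 : ℝ) : ℂ) + w) ^ (b : ℂ))
    (g := fun u => Real.exp (a * u) * (1 + u) ^ b) hβ0 hβ1 ?_ ?_ ?_ ?_
  · exact DifferentiableOn.mul (by fun_prop) (differentiableOn_const_add_cpow 1 b zero_le_one)
  · intro u hu
    rw [ofReal_mul, ofReal_exp, ofReal_cpow (by linarith)]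
    push_cast; rfl
  · intro u hu; positivity
  · intro w hw ha hs
    obtain ⟨h2, h3⟩ := arg_ofReal_add_le zero_le_one hw
    rw [exp_mul_cpow_im (slitPlane_ne_zero (ofReal_add_mem_slitPlane zero_le_one (Or.inr hw.ne')))]
    refine mul_nonneg (Real.exp_pos _).le (Real.sin_nonneg_of_nonneg_of_le_pi (by positivity) ?_)
    have := mul_le_mul_of_nonneg_right ha1 hw.le
    have := mul_le_mul_of_nonneg_right hb1 h2.le
    linarith

open Complex in
/-- `1 - exp (-a W(x^β)) (1 + W(x^β)) ^ (-b)` for exponents `0 ≤ a, b ≤ 1`. -/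
theorem isStieltjes_one_sub_exp_mul_one_add_rpow {a b β : ℝ} (hβ0 : -1 ≤ β) (hβ1 : β ≤ 0)
    (ha0 : 0 ≤ a) (ha1 : a ≤ 1) (hb0 : 0 ≤ b) (hb1 : b ≤ 1) :
    IsStieltjes fun x =>
      1 - Real.exp (-a * lambertW (x ^ β)) * (1 + lambertW (x ^ β)) ^ (-b) := by
  refine isStieltjes_comp_lambertW_neg
    (G := fun w => 1 - exp ((-a : ℝ) * w) * (((1 : ℝ) : ℂ) + w) ^ ((-b : ℝ) : ℂ))
    (g := fun u => 1 - Real.exp (-a * u) * (1 + u) ^ (-b)) hβ0 hβ1 ?_ ?_ ?_ ?_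
  · exact (DifferentiableOn.mul (by fun_prop)
      (differentiableOn_const_add_cpow 1 (-b) zero_le_one)).const_sub _
  · intro u hu
    rw [ofReal_sub, ofReal_mul, ofReal_exp, ofReal_cpow (by linarith)]
    push_cast; rfl
  · intro u hu
    have h1 : Real.exp (-a * u) ≤ 1 := Real.exp_le_one_iff.2 (by nlinarith)
    have h2 : (1 + u) ^ (-b) ≤ 1 := Real.rpow_le_one_of_one_le_of_nonpos (by linarith)
      (by linarith)
    exact sub_nonneg.2 (mul_le_one₀ h1 (by positivity) h2)
  · intro w hw ha hs
    obtain ⟨h2, h3⟩ := arg_ofReal_add_le zero_le_one hw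
    rw [sub_im, one_im, exp_mul_cpow_im
      (slitPlane_ne_zero (ofReal_add_mem_slitPlane zero_le_one (Or.inr hw.ne'))), zero_sub,
      ← mul_neg, ← Real.sin_neg]
    have := mul_le_mul_of_nonneg_right ha1 hw.le
    have := mul_le_mul_of_nonneg_right hb1 h2.le
    have := mul_nonneg ha0 hw.le
    have := mul_nonneg hb0 h2.le
    exact mul_nonneg (Real.exp_pos _).le
      (Real.sin_nonneg_of_nonneg_of_le_pi (by linarith) (by linarith))

-- The angle is `-(Im w + arg (c + w))`, which lies above `-π` because adding `c` only decreases the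
-- argument.
open Complex in
theorem isStieltjes_exp_neg_div_add {c : ℝ} (hc : 0 ≤ c) :
    IsStieltjes fun x => Real.exp (-lambertW (x ^ (1 : ℝ))) / (c + lambertW (x ^ (1 : ℝ))) := by
  refine isStieltjes_comp_lambertW (G := fun w => exp ((-1 : ℝ) * w) * (c + w) ^ ((-1 : ℝ) : ℂ))
    (g := fun u => Real.exp (-u) / (c + u)) zero_le_one le_rfl ?_ ?_ ?_ ?_
  · exact DifferentiableOn.mul (by fun_prop) (differentiableOn_const_add_cpow c (-1) hc)
  · intro u hu
    push_cast
    rw [cpow_neg_one, neg_one_mul, div_eq_mul_inv]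
  · intro u hu; positivity
  · intro w hw ha hs
    obtain ⟨h2, h3⟩ := arg_ofReal_add_le hc hw
    rw [exp_mul_cpow_im (slitPlane_ne_zero (ofReal_add_mem_slitPlane hc (Or.inr hw.ne')))]
    refine mul_nonpos_of_nonneg_of_nonpos (Real.exp_pos _).le ?_
    exact Real.sin_nonpos_of_nonpos_of_neg_pi_le (by linarith) (by linarith)

open Complex in
theorem isStieltjes_one_sub_exp_neg_div :
    IsStieltjes fun x =>
      (1 - Real.exp (-lambertW (x ^ (1 : ℝ)))) / lambertW (x ^ (1 : ℝ)) := by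
  refine isStieltjes_comp_lambertW (G := fun w => (1 - exp (-w)) / w)
    (g := fun u => (1 - Real.exp (-u)) / u) zero_le_one le_rfl ?_ ?_ ?_ ?_
  · intro w hw
    exact (DifferentiableAt.div (by fun_prop) (by fun_prop)
      (slitPlane_ne_zero hw)).differentiableWithinAt
  · intro u hu; push_cast; rfl
  · intro u hu
    exact div_nonneg (sub_nonneg.2 (Real.exp_le_one_iff.2 (by linarith))) hu.le
  · intro w hw ha hs
    have hw0 : w ≠ 0 := fun h => by simp [h] at hw
    -- Each integrand has angle `-t Im w ∈ [-π, 0]`, so the sign can be read off pointwise.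
    have h1 : (1 - exp (-w)) / w = ∫ t in (0 : ℝ)..1, exp (-w * t) := by
      rw [integral_exp_mul_complex (neg_ne_zero.2 hw0)]
      simp only [ofReal_one, mul_one, ofReal_zero, mul_zero, exp_zero]
      rw [div_neg, ← neg_div, neg_sub]
    have hc : Continuous fun t : ℝ => exp (-w * t) := by fun_prop
    rw [h1, ← imCLM_apply, ← ContinuousLinearMap.intervalIntegral_comp_comm _
      (hc.intervalIntegrable _ _)]
    rw [← neg_nonneg, ← intervalIntegral.integral_neg]
    refine intervalIntegral.integral_nonneg zero_le_one fun t ht => neg_nonneg.2 ?_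
    rw [imCLM_apply, exp_im]
    refine mul_nonpos_of_nonneg_of_nonpos (Real.exp_pos _).le ?_
    have h2 : (-w * t).im = -(t * w.im) := by simp [mul_comm]
    have h3 := mul_nonneg ht.1 hw.le
    have h4 := mul_le_mul_of_nonneg_right ht.2 hw.le
    rw [h2]
    exact Real.sin_nonpos_of_nonpos_of_neg_pi_le (by linarith) (by linarith)

open Complex in
theorem isStieltjes_one_div_add_rpow {c α : ℝ} (hc : 0 ≤ c) (h0 : 0 ≤ α) (h1 : α ≤ 1) :
    IsStieltjes fun x => 1 / (c + x ^ α) := by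
  refine isStieltjes_of_upper (f := fun z => 1 / (c + z ^ (α : ℂ))) ?_ ?_ ?_ ?_
  · intro z hz
    refine (DifferentiableAt.div (by fun_prop) ((differentiableAt_id.cpow_const hz).const_add _)
      ?_).differentiableWithinAt
    have hz0 := slitPlane_ne_zero hz
    have harg : |z.arg| < Real.pi := by
      rw [abs_lt]
      exact ⟨neg_pi_lt_arg z, lt_of_le_of_ne (arg_le_pi z) (slitPlane_arg_ne_pi hz)⟩
    -- As `|α arg z| < π`, the power stays off the cut, and adding `c ≥ 0` cannot reach `0`.
    refine slitPlane_ne_zero (ofReal_add_mem_slitPlane hc ?_)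
    rw [mem_slitPlane_iff_arg]
    have hmul : |α * z.arg| < Real.pi := by
      rw [abs_mul, abs_of_nonneg h0]; nlinarith [abs_nonneg z.arg]
    have him : (log z * α).im = α * z.arg := by rw [mul_comm, im_ofReal_mul, log_im]
    refine ⟨?_, by simp [cpow_def_of_ne_zero hz0]⟩
    simp only [id]
    rw [cpow_def_of_ne_zero hz0, arg_exp, him, (toIocMod_eq_self _).2]
    · exact (abs_lt.1 hmul).2.ne
    · exact ⟨(abs_lt.1 hmul).1, by linarith [(abs_lt.1 hmul).2]⟩
  · intro x hx
    push_cast [ofReal_cpow hx.le]; rfl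
  · intro x hx; positivity
  · intro z hz
    have ha := arg_pos_of_im_pos hz
    refine one_div_im_nonpos ?_
    rw [add_im, ofReal_im, zero_add, cpow_im_eq (fun h => by simp [h] at hz)]
    refine mul_nonneg (Real.exp_pos _).le (Real.sin_nonneg_of_nonneg_of_le_pi (by positivity) ?_)
    nlinarith [arg_le_pi z]

/-! ### Translation into the listed functions. -/

theorem div_lambertW_eq_exp {y : ℝ} (hy : 0 < y) : y / lambertW y = Real.exp (lambertW y) := by
  rw [div_eq_iff (lambertW_pos hy).ne', mul_comm, lambertW_mul_exp hy]

/-- Powers of the identity `y / W(y) = exp (W(y))` with `y = x ^ β`. -/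
theorem rpow_mul_lambertW_rpow {x : ℝ} (hx : 0 < x) (β a : ℝ) :
    x ^ (β * a) * lambertW (x ^ β) ^ (-a) = Real.exp (a * lambertW (x ^ β)) := by
  have hy := Real.rpow_pos_of_pos hx β
  rw [Real.rpow_mul hx.le, Real.rpow_neg (lambertW_pos hy).le, ← div_eq_mul_inv,
    ← Real.div_rpow hy.le (lambertW_pos hy).le, div_lambertW_eq_exp hy, ← Real.exp_mul, mul_comm]


theorem mainTheorem3 :
    (∀ c : ℝ, 0 ≤ c → IsStieltjes (fun x : ℝ => 1 / (c + lambertW x))) ∧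
    (∀ α : ℝ, 0 ≤ α → α ≤ 1 → IsStieltjes (fun x : ℝ => lambertW (1 / x) ^ α)) ∧
    (∀ β : ℝ, -1 ≤ β → β ≤ 0 → IsStieltjes (fun x : ℝ => x ^ β * lambertW (1 / x) ^ β)) ∧
    (∀ c : ℝ, 0 ≤ c → IsStieltjes (fun x : ℝ => lambertW x / (x * (c + lambertW x)))) ∧
    IsStieltjes (fun x : ℝ => 1 / lambertW x - 1 / x) ∧
    (∀ c β : ℝ, 0 ≤ c → -1 ≤ β → β ≤ 0 →
      IsStieltjes (fun x : ℝ => c + lambertW (x ^ β))) ∧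
    (∀ c α : ℝ, 0 ≤ c → 0 ≤ α → α ≤ 1 →
      IsStieltjes (fun x : ℝ => 1 / (c + lambertW (x ^ α)))) ∧
    (∀ α β γ : ℝ, 0 ≤ α → α ≤ 1 → -1 ≤ β → β ≤ 0 → 0 ≤ γ → γ ≤ 1 →
      IsStieltjes (fun x : ℝ => x ^ (α * β * γ) * lambertW (x ^ β) ^ (-(α * γ)) *
        (1 + lambertW (x ^ β)) ^ (1 - γ))) ∧
    (∀ c α : ℝ, 0 ≤ c → 0 ≤ α → α ≤ 1 → IsStieltjes (fun x : ℝ => 1 / (c + x ^ α))) ∧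
    (∀ α : ℝ, 0 ≤ α → α ≤ 1 →
      IsStieltjes (fun x : ℝ => 1 - x ^ α * lambertW (1 / x) ^ α)) ∧
    (∀ α β : ℝ, 0 ≤ α → α ≤ 1 → -1 ≤ β → β ≤ 0 →
      IsStieltjes (fun x : ℝ => 1 - x ^ (-(α * β)) * lambertW (x ^ β) ^ α *
        (1 + lambertW (x ^ β)) ^ (-α))) := by
  have hone : ∀ x : ℝ, 0 < x → 1 / x = x ^ (-1 : ℝ) := fun x hx => by
    rw [Real.rpow_neg_one, one_div]
  refine ⟨fun c hc => ?_, fun α h0 h1 => ?_, fun β h0 h1 => ?_, fun c hc => ?_, ?_,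
    fun c β hc h0 h1 => isStieltjes_add_lambertW_rpow hc h0 h1,
    fun c α hc h0 h1 => isStieltjes_one_div_add_lambertW_rpow hc h0 h1,
    fun α β γ hα0 hα1 hβ0 hβ1 hγ0 hγ1 => ?_,
    fun c α hc h0 h1 => isStieltjes_one_div_add_rpow hc h0 h1,
    fun α h0 h1 => ?_, fun α β hα0 hα1 hβ0 hβ1 => ?_⟩
  · simpa using isStieltjes_one_div_add_lambertW_rpow hc zero_le_one le_rfl
  · exact (isStieltjes_lambertW_inv_rpow h0 h1).congr fun x hx => by rw [hone x hx]
  -- Here `x W(1/x) = exp (-W(1/x))` is raised to the power `β`; the inner exponent is `-1`.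
  · refine (isStieltjes_exp_mul_one_add_rpow (a := -β) (b := 0) (β := -1) le_rfl (by norm_num)
      (by linarith) (by linarith) le_rfl zero_le_one).congr fun x hx => ?_
    rw [Real.rpow_zero, mul_one, ← rpow_mul_lambertW_rpow hx, hone x hx]
    norm_num
  · refine (isStieltjes_exp_neg_div_add hc).congr fun x hx => ?_
    have h1 := div_lambertW_eq_exp hx
    have h2 := lambertW_pos hx
    rw [Real.rpow_one, Real.exp_neg, ← h1, inv_div, div_div]
  · refine isStieltjes_one_sub_exp_neg_div.congr fun x hx => ?_
    have h1 := div_lambertW_eq_exp hx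
    have h2 := lambertW_pos hx
    rw [Real.rpow_one, Real.exp_neg, ← h1, inv_div, sub_div, div_right_comm, div_self h2.ne']
  · refine (isStieltjes_exp_mul_one_add_rpow (a := α * γ) (b := 1 - γ) hβ0 hβ1
      (mul_nonneg hα0 hγ0) (mul_le_one₀ hα1 hγ0 hγ1) (by linarith) (by linarith)).congr
      fun x hx => ?_
    rw [← rpow_mul_lambertW_rpow hx, show β * (α * γ) = α * β * γ by ring]
  · refine (isStieltjes_one_sub_exp_mul_one_add_rpow (a := α) (b := 0) (β := -1) le_rfl
      (by norm_num) h0 h1 le_rfl zero_le_one).congr fun x hx => ?_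
    rw [neg_zero, Real.rpow_zero, mul_one, ← rpow_mul_lambertW_rpow hx, hone x hx]
    norm_num
  · refine (isStieltjes_one_sub_exp_mul_one_add_rpow (a := α) (b := α) hβ0 hβ1
      hα0 hα1 hα0 hα1).congr fun x hx => ?_
    rw [← rpow_mul_lambertW_rpow hx, neg_neg, show β * -α = -(α * β) by ring]
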